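/- Let $\mathscr{A}$ be a Banach $^*$-algebra, that is, a complex (not necessarily unital) $^*$-algebra with a complete submultiplicative norm; the involution is not assumed to be continuous. Let $\mathscr{M}$ be a left ideal of $\mathscr{A}$ and $f:\mathscr{M}\to\mathbb{C}$ a linear functional, and assume that for some constant $C\geq 0$ $$|f(a)|^2\leq C\cdot f(a^*a)\qquad\text{for all } a\in\mathscr{M}$$ (in particular $C\cdot f(a^*a)$ is real). Then the following hold. For every $a\in\mathscr{M}$ the conjugate-linear functional $Aa:x\mapsto f(x^*a)$ on $\mathscr{A}$ is continuous, so that $A:a\mapsto Aa$ is a linear operator from $\mathscr{M}\subseteq\mathscr{A}$ into the space of continuous conjugate-linear functionals on $\mathscr{A}$. It is positive, i.e. $(Aa)(a)=f(a^*a)\geq 0$ for all $a\in\mathscr{M}$, and there is a constant $K\geq 0$ with $\|Aa\|^2\leq K\cdot (Aa)(a)$ for all $a\in\mathscr{M}$. Hence $\langle Aa, Ab\rangle_A:=(Aa)(b)=f(b^*a)$ is a well-defined inner product on the range of $A$ (linear in the first variable); let $H_A$ be the Hilbert space completion of the range of $A$ with respect to it. There is a $^*$-representation $\pi_A:\mathscr{A}\to\mathscr{B}(H_A)$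 with $\pi_A(x)(Aa)=A(xa)$ for all $x\in\mathscr{A}$, $a\in\mathscr{M}$, and there is a cyclic vector $\zeta_A\in H_A$ of $\pi_A$, i.e. $\{\pi_A(x)\zeta_A : x\in\mathscr{A}\}$ is dense in $H_A$, such that $$f(a)=\langle\pi_A(a)\zeta_A,\zeta_A\rangle_A\qquad\text{for all } a\in\mathscr{M}.$$ -/

import Mathlib

open scoped ComplexOrder ComplexConjugate InnerProductSpace

noncomputable section

namespace KreinVonNeumann

section Operators

variable {E : Type*} [NormedAddCommGroup E] [NormedSpace ℂ E]

/-- The topological antidual of `E`: the continuous conjugate-linear functionals on `E`. -/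
abbrev Antidual (E : Type*) [NormedAddCommGroup E] [NormedSpace ℂ E] : Type _ := E →L⋆[ℂ] ℂ

/-- A (not necessarily everywhere defined) linear operator `A` from `E` into its antidual is
positive if `(A x)(x) ≥ 0` for all `x` in the domain of `A`. -/
def IsPositiveOp (A : E →ₗ.[ℂ] Antidual E) : Prop :=
  ∀ x : A.domain, 0 ≤ A x (x : E)

/-- The Schwarz-type inequality `‖A x‖² ≤ K · (A x)(x)` for some constant `K ≥ 0`. -/
def IsSchwarzBounded (A : E →ₗ.[ℂ] Antidual E) : Prop :=
  ∃ K : ℝ, 0 ≤ K ∧ ∀ x : A.domain, ((‖A x‖ ^ 2 : ℝ) : ℂ) ≤ (K : ℂ) * A x (x : E)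

/-- A positive operator is symmetric. -/
theorem IsPositiveOp.symm {A : E →ₗ.[ℂ] Antidual E} (hA : IsPositiveOp A) (x y : A.domain) :
    A x (y : E) = conj (A y (x : E)) := by
  have him : ∀ z : A.domain, (A z (z : E)).im = 0 := fun z =>
    ((Complex.nonneg_iff.1 (hA z)).2).symm
  have h1 := him (x + y)
  have h2 := him (Complex.I • x + y)
  have hx := him x
  have hy := him y
  simp [LinearPMap.map_add, LinearPMap.map_smul] at h1 h2
  rw [hx, hy] at h1 h2
  apply Complex.ext
  · simp
    linarith
  · simp
    linarith

/-- The range `ran A` of a positive operator `A` satisfying the Schwarz-type inequality, as a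
type of its own. It is to carry the inner product `⟨A x, A y⟩_A = (A x)(y)` and not the norm of the
antidual. -/
def RanSpace (A : E →ₗ.[ℂ] Antidual E) (_hA : IsPositiveOp A) (_hS : IsSchwarzBounded A) : Type _ :=
  LinearMap.range A.toFun

namespace RanSpace

variable {A : E →ₗ.[ℂ] Antidual E} {hA : IsPositiveOp A} {hS : IsSchwarzBounded A}

instance instAddCommGroup : AddCommGroup (RanSpace A hA hS) :=
  inferInstanceAs (AddCommGroup (LinearMap.range A.toFun))

instance instModule : Module ℂ (RanSpace A hA hS) :=
  inferInstanceAs (Module ℂ (LinearMap.range A.toFun))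

variable (A hA hS) in
/-- The operator `A` as a linear map of its domain onto `ran A`. -/
def mk : A.domain →ₗ[ℂ] RanSpace A hA hS := A.toFun.rangeRestrict

variable (A hA hS) in
theorem mk_surjective : Function.Surjective (mk A hA hS) := A.toFun.surjective_rangeRestrict

theorem mk_eq_zero_iff (x : A.domain) : mk A hA hS x = 0 ↔ A x = 0 := by
  refine ⟨fun h => ?_, fun h => Subtype.ext h⟩
  exact congrArg (fun u : LinearMap.range A.toFun => (u : Antidual E)) h

/-- A vector in the domain of `A` that `A` sends to the given element of `ran A`. -/
def rep (u : RanSpace A hA hS) : A.domain := (mk_surjective A hA hS u).choose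

theorem mk_rep (u : RanSpace A hA hS) : mk A hA hS (rep u) = u :=
  (mk_surjective A hA hS u).choose_spec

theorem apply_rep_mk (x : A.domain) : A (rep (mk A hA hS x)) = A x := by
  have h := mk_rep (mk A hA hS x)
  exact congrArg (fun u : LinearMap.range A.toFun => (u : Antidual E)) h

/-- The inner product of `ran A`. It is conjugate-linear in the first variable, as everywhere in
Mathlib: `inner ℂ (A x) (A y) = (A y)(x)`; see `inner_mk_mk`. -/
instance instInner : Inner ℂ (RanSpace A hA hS) :=
  ⟨fun u v => A (rep v) (rep u : E)⟩

theorem inner_mk_mk (x y : A.domain) :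
    inner ℂ (mk A hA hS x) (mk A hA hS y) = A y (x : E) := by
  change A (rep (mk A hA hS y)) (rep (mk A hA hS x) : E) = A y (x : E)
  rw [apply_rep_mk, hA.symm, apply_rep_mk, ← hA.symm]

variable (A hA hS) in
/-- The axioms of an inner product. -/
@[reducible]
def core : InnerProductSpace.Core ℂ (RanSpace A hA hS) where
  inner := inner ℂ
  conj_inner_symm u v := by
    obtain ⟨x, rfl⟩ := mk_surjective A hA hS u
    obtain ⟨y, rfl⟩ := mk_surjective A hA hS v
    rw [inner_mk_mk, inner_mk_mk, ← hA.symm]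
  re_inner_nonneg u := by
    obtain ⟨x, rfl⟩ := mk_surjective A hA hS u
    rw [inner_mk_mk]
    exact (Complex.nonneg_iff.1 (hA x)).1
  add_left u v w := by
    obtain ⟨x, rfl⟩ := mk_surjective A hA hS u
    obtain ⟨y, rfl⟩ := mk_surjective A hA hS v
    obtain ⟨z, rfl⟩ := mk_surjective A hA hS w
    rw [← map_add, inner_mk_mk, inner_mk_mk, inner_mk_mk, Submodule.coe_add, map_add]
  smul_left u v r := by
    obtain ⟨x, rfl⟩ := mk_surjective A hA hS u
    obtain ⟨y, rfl⟩ := mk_surjective A hA hS v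
    rw [← map_smul, inner_mk_mk, inner_mk_mk, Submodule.coe_smul, ContinuousLinearMap.map_smulₛₗ,
      smul_eq_mul]
  definite u h := by
    obtain ⟨x, rfl⟩ := mk_surjective A hA hS u
    rw [inner_mk_mk] at h
    have h2 : ‖A x‖ ^ 2 ≤ 0 := by
      obtain ⟨K, -, hK⟩ := hS
      have h1 := hK x
      rw [h, mul_zero] at h1
      exact_mod_cast h1
    rw [mk_eq_zero_iff]
    exact norm_eq_zero.1 ((pow_eq_zero_iff two_ne_zero).1 (le_antisymm h2 (sq_nonneg _)))

instance instNormedAddCommGroup : NormedAddCommGroup (RanSpace A hA hS) :=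
  (core A hA hS).toNormedAddCommGroup

instance instInnerProductSpace : InnerProductSpace ℂ (RanSpace A hA hS) :=
  InnerProductSpace.ofCore (core A hA hS).toCore

end RanSpace

/-- The auxiliary Hilbert space `H_A` of a positive operator `A` satisfying the Schwarz-type
inequality: the completion of `ran A` in the inner product `⟨A x, A y⟩_A = (A x)(y)`. -/
abbrev AuxHilbert (A : E →ₗ.[ℂ] Antidual E) (hA : IsPositiveOp A) (hS : IsSchwarzBounded A) :
    Type _ :=
  UniformSpace.Completion (RanSpace A hA hS)

end Operators

section Functionals

variable {𝒜 : Type*} [NonUnitalNormedRing 𝒜] [NormedSpace ℂ 𝒜] [IsScalarTower ℂ 𝒜 𝒜]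
  [SMulCommClass ℂ 𝒜 𝒜] [StarRing 𝒜] [StarModule ℂ 𝒜]

/-- A linear subspace `M` of the algebra is a left ideal if `x a ∈ M` for all `x` in the algebra
and all `a ∈ M`. -/
def IsLeftIdeal (M : Submodule ℂ 𝒜) : Prop :=
  ∀ (x : 𝒜) (a : 𝒜), a ∈ M → x * a ∈ M

/-- The element `x a` of the left ideal `M`, for `x` in the algebra and `a ∈ M`. -/
def IsLeftIdeal.mul {M : Submodule ℂ 𝒜} (hM : IsLeftIdeal M) (x : 𝒜) (a : M) : M :=
  ⟨x * (a : 𝒜), hM x a a.2⟩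

/-- The condition `|f(a)|² ≤ C f(a* a)` for all `a ∈ M`. As an inequality in `ℂ` it includes that
the right-hand side is real. -/
def IsCyclicBounded {M : Submodule ℂ 𝒜} (hM : IsLeftIdeal M) (f : M →ₗ[ℂ] ℂ) (C : ℝ) : Prop :=
  ∀ a : M, ((‖f a‖ ^ 2 : ℝ) : ℂ) ≤ (C : ℂ) * f (hM.mul (star (a : 𝒜)) a)

/-- For each `a ∈ M` the functional `x ↦ f(x* a)` is continuous on the algebra. -/
def HasContinuousTranslates {M : Submodule ℂ 𝒜} (hM : IsLeftIdeal M) (f : M →ₗ[ℂ] ℂ) : Prop :=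
  ∀ a : M, Continuous fun x : 𝒜 => f (hM.mul (star x) a)

/-- The operator `A`, with domain `M` and values in the antidual of the algebra, induced by `f`:
`(A a)(x) = f(x* a)`. -/
@[reducible]
def inducedOp {M : Submodule ℂ 𝒜} (hM : IsLeftIdeal M) (f : M →ₗ[ℂ] ℂ)
    (hf : HasContinuousTranslates hM f) : 𝒜 →ₗ.[ℂ] Antidual 𝒜 where
  domain := M
  toFun :=
    { toFun := fun a =>
        { toFun := fun x => f (hM.mul (star x) a)
          map_add' := fun x y => by
            rw [← map_add]
            congr 1
            exact Subtype.ext (by simp [IsLeftIdeal.mul, add_mul])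
          map_smul' := fun c x => by
            rw [← map_smul]
            congr 1
            exact Subtype.ext (by simp [IsLeftIdeal.mul, smul_mul_assoc])
          cont := hf a }
      map_add' := fun a b => by
        ext x
        change f _ = f _ + f _
        rw [← map_add]
        congr 1
        exact Subtype.ext (by simp [IsLeftIdeal.mul, mul_add])
      map_smul' := fun c a => by
        ext x
        change f _ = c • f _
        rw [← map_smul]
        congr 1
        exact Subtype.ext (by simp [IsLeftIdeal.mul, mul_smul_comm]) }

end Functionals

section Representations

variable {𝒜 : Type*} [NonUnitalNormedRing 𝒜] [NormedSpace ℂ 𝒜] [StarRing 𝒜]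
  {H : Type*} [NormedAddCommGroup H] [InnerProductSpace ℂ H] [CompleteSpace H]

/-- `ζ` is a (topologically) cyclic vector of the representation `π` on the Hilbert space `H`:
the set of all `π(x) ζ`, with `x` in the algebra, is dense in `H`. -/
def IsCyclicVector (π : 𝒜 →⋆ₙₐ[ℂ] (H →L[ℂ] H)) (ζ : H) : Prop :=
  Dense (Set.range fun x : 𝒜 => π x ζ)

end Representations

end KreinVonNeumann

end

open scoped ComplexOrder ComplexConjugate InnerProductSpace

noncomputable section

namespace KreinVonNeumann

open Filter Topology Set

/-! ### Spectral radius bounds and a three circles theorem -/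

section BanachAlgebra

/-! The form (a, b) ↦ f(a* b) on M is positive semidefinite, and left multiplication by x has left
multiplication by x* as its adjoint. Everything follows once f((x a)* (x a)) ≤ K ‖x‖² f(a* a),
together with the same bound for x* a. Then |f(x* a)|² ≤ C f((x* a)* (x* a)) yields the continuity
of A a and the Schwarz inequality, and the action extends to H_A. Since |f(a)| ≤ √C ‖A a‖_A, Riesz
gives ζ with f(a) = ⟨A a, ζ⟩, and π(a) ζ = A a because pairing either with A b gives f(a* b). So ζ
is cyclic, as ran A is dense.

The bound is automatic continuity of a `*`-action L on a pre-Hilbert space. By Ford's square root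
lemma, 1 - h is the square of a self-adjoint element when h is self-adjoint and ‖h‖ < 1; hence ‖L x
a‖² ≤ ‖x* x‖ ‖a‖². For a continuous involution this would suffice. In general, let S be the
separating space: the limits of x_n* with x_n → 0. For y in S a three circles argument shows that y*
y is quasinilpotent, and a symmetric L x is bounded by the spectral radius of x, so S acts by zero.
The open mapping theorem on the closed graph closure gives v with ‖v‖ ≤ c ‖x‖ and v - x* in S. Thus
x* x acts as v x, with norm at most c ‖x‖². -/

theorem norm_pow_mul_le_of_norm_pow_le {B : Type*} [NormedRing B] {x : B} {c : ℝ} {n m : ℕ}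
    (hm : m ≠ 0) (h : ‖x ^ n‖ ≤ c ^ n) : ‖x ^ (n * m)‖ ≤ c ^ (n * m) := by
  rw [pow_mul, pow_mul]
  exact (norm_pow_le' _ (Nat.pos_of_ne_zero hm)).trans
    (pow_le_pow_left₀ (norm_nonneg _) h m)

variable {B : Type*} [NormedRing B] [NormedAlgebra ℂ B] [CompleteSpace B]

theorem eventually_norm_pow_le_of_spectralRadius_lt {x : B} {c : ℝ}
    (h : spectralRadius ℂ x < ENNReal.ofReal c) : ∀ᶠ n : ℕ in atTop, ‖x ^ n‖ ≤ c ^ n := by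
  have hc : 0 < c := ENNReal.ofReal_pos.1 (bot_le.trans_lt h)
  have hlim := spectrum.pow_norm_pow_one_div_tendsto_nhds_spectralRadius x
  filter_upwards [hlim.eventually_lt_const h, eventually_gt_atTop 0] with n hn hn0
  have h1 : ‖x ^ n‖ ^ (1 / n : ℝ) < c := (ENNReal.ofReal_lt_ofReal_iff hc).1 hn
  have h2 := pow_le_pow_left₀ (by positivity) h1.le n
  rwa [one_div, Real.rpow_inv_natCast_pow (norm_nonneg _) hn0.ne'] at h2

theorem spectralRadius_le_of_norm_pow_le [NormOneClass B] {x : B} {c : ℝ} (hc : 0 ≤ c) {n : ℕ}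
    (hn : n ≠ 0) (h : ‖x ^ n‖ ≤ c ^ n) : spectralRadius ℂ x ≤ ENNReal.ofReal c := by
  rw [← ENNReal.pow_le_pow_left_iff hn]
  calc spectralRadius ℂ x ^ n ≤ spectralRadius ℂ (x ^ n) := spectrum.spectralRadius_pow_le x n hn
    _ ≤ ‖x ^ n‖₊ := spectrum.spectralRadius_le_nnnorm _
    _ = ENNReal.ofReal ‖x ^ n‖ := (ofReal_norm _).symm
    _ ≤ ENNReal.ofReal (c ^ n) := ENNReal.ofReal_le_ofReal h
    _ = ENNReal.ofReal c ^ n := ENNReal.ofReal_pow hc n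

theorem spectralRadius_lt_of_norm_lt [NormOneClass B] {x : B} {c : ℝ} (h : ‖x‖ < c) :
    spectralRadius ℂ x < ENNReal.ofReal c :=
  (spectralRadius_le_of_norm_pow_le (norm_nonneg x) one_ne_zero (by simp)).trans_lt
    ((ENNReal.ofReal_lt_ofReal_iff ((norm_nonneg x).trans_lt h)).2 h)

/-- On a compact set, a pointwise strict bound for the spectral radius of a continuous function
yields a uniform bound for the norm of a suitable power. -/
theorem exists_forall_norm_pow_le_of_isCompact {T : Type*} [TopologicalSpace T] {K : Set T}
    (hK : IsCompact K) {p : T → B} (hp : Continuous p) {c : ℝ}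
    (h : ∀ z ∈ K, spectralRadius ℂ (p z) < ENNReal.ofReal c) :
    ∃ n : ℕ, n ≠ 0 ∧ ∀ z ∈ K, ‖p z ^ n‖ ≤ c ^ n := by
  refine hK.induction_on (p := fun s => ∃ n : ℕ, n ≠ 0 ∧ ∀ z ∈ s, ‖p z ^ n‖ ≤ c ^ n)
    ⟨1, one_ne_zero, by simp⟩ ?_ ?_ ?_
  · rintro s t hst ⟨n, hn, H⟩
    exact ⟨n, hn, fun z hz => H z (hst hz)⟩
  · rintro s t ⟨n, hn, H⟩ ⟨m, hm, H'⟩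
    -- A bound for one exponent passes to its multiples, so the product serves both pieces.
    refine ⟨n * m, mul_ne_zero hn hm, ?_⟩
    rintro z (hz | hz)
    · exact norm_pow_mul_le_of_norm_pow_le hm (H z hz)
    · rw [mul_comm]
      exact norm_pow_mul_le_of_norm_pow_le hn (H' z hz)
  · intro z hz
    -- Room between the spectral radius and c makes the inequality at z strict, hence valid near z
    -- for the same exponent.
    obtain ⟨d, hd0, hd, hdc⟩ : ∃ d : ℝ, 0 < d ∧
        spectralRadius ℂ (p z) < ENNReal.ofReal d ∧ d < c := by
      obtain ⟨e, he, hec⟩ := exists_between (h z hz)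
      have het : e ≠ ⊤ := (hec.trans ENNReal.ofReal_lt_top).ne
      refine ⟨e.toReal, ENNReal.toReal_pos (bot_le.trans_lt he).ne' het, ?_, ?_⟩
      · rwa [ENNReal.ofReal_toReal het]
      · rwa [← ENNReal.lt_ofReal_iff_toReal_lt het]
    obtain ⟨n, hn, hn0⟩ := ((eventually_norm_pow_le_of_spectralRadius_lt hd).and
      (eventually_gt_atTop 0)).exists
    have hlt : ‖p z ^ n‖ < c ^ n := hn.trans_lt (pow_lt_pow_left₀ hdc hd0.le hn0.ne')
    have hev : ∀ᶠ y in 𝓝 z, ‖p y ^ n‖ < c ^ n :=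
      ((hp.pow n).norm.tendsto z).eventually_lt_const hlt
    exact ⟨_, mem_nhdsWithin_of_mem_nhds hev, n, hn0.ne', fun y hy => le_of_lt hy⟩

/-- A three circles theorem for the spectral radius of the affine function `z ↦ a + z b`. -/
theorem spectralRadius_add_le_of_circles [NormOneClass B] {a b : B} {R α β : ℝ} (hR : 1 < R)
    (hα : 0 < α) (hβ : 0 < β)
    (h1 : ∀ z : ℂ, ‖z‖ = R⁻¹ → spectralRadius ℂ (a + z • b) < ENNReal.ofReal α)
    (h2 : ∀ z : ℂ, ‖z‖ = R → spectralRadius ℂ (a + z • b) < ENNReal.ofReal β) :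
    spectralRadius ℂ (a + b) ≤ ENNReal.ofReal √(α * β) := by
  have hR0 : 0 < R := one_pos.trans hR
  have hp : Continuous fun z : ℂ => a + z • b := by fun_prop
  obtain ⟨n, hn, H1⟩ := exists_forall_norm_pow_le_of_isCompact (isCompact_sphere (0 : ℂ) R⁻¹) hp
    (fun z hz => h1 z (by simpa using hz))
  obtain ⟨m, hm, H2⟩ := exists_forall_norm_pow_le_of_isCompact (isCompact_sphere (0 : ℂ) R) hp
    (fun z hz => h2 z (by simpa using hz))
  replace H1 : ∀ z : ℂ, ‖z‖ = R⁻¹ → ‖(a + z • b) ^ (n * m)‖ ≤ α ^ (n * m) := fun z hz =>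
    norm_pow_mul_le_of_norm_pow_le hm (H1 z (by simpa using hz))
  replace H2 : ∀ z : ℂ, ‖z‖ = R → ‖(a + z • b) ^ (n * m)‖ ≤ β ^ (n * m) := fun z hz => by
    rw [mul_comm]
    exact norm_pow_mul_le_of_norm_pow_le hn (H2 z (by simpa using hz))
  have hN : n * m ≠ 0 := mul_ne_zero hn hm
  generalize n * m = N at H1 H2 hN
  let U : Set ℂ := norm ⁻¹' Ioo R⁻¹ R
  have hRR : R⁻¹ < 1 := inv_lt_one_of_one_lt₀ hR
  have hU : Bornology.IsBounded U :=
    Metric.isBounded_closedBall.subset fun z (hz : ‖z‖ ∈ Ioo R⁻¹ R) =>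
      mem_closedBall_zero_iff.2 hz.2.le
  have hcl : closure U ⊆ {z | z ≠ 0} := fun z hz => by
    have h3 := continuous_norm.closure_preimage_subset _ hz
    rw [closure_Ioo (hRR.trans hR).ne] at h3
    exact norm_pos_iff.1 ((inv_pos.2 hR0).trans_le h3.1)
  -- On either boundary circle one factor is evaluated at radius R⁻¹ and the other at R, so the
  -- product is at most (αβ)^N. At z = 1 it equals (a + b)^(2N), and the maximum principle applies.
  have hd : DiffContOnCl ℂ (fun z : ℂ => (a + z • b) ^ N * (a + z⁻¹ • b) ^ N) U := by
    apply DifferentiableOn.diffContOnCl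
    intro z hz
    have hz0 : z ≠ 0 := hcl hz
    have hinv : DifferentiableAt ℂ (fun z : ℂ => z⁻¹) z := differentiableAt_inv hz0
    apply DifferentiableAt.differentiableWithinAt
    fun_prop
  have hfr : ∀ z ∈ frontier U, ‖(a + z • b) ^ N * (a + z⁻¹ • b) ^ N‖ ≤ (α * β) ^ N := by
    intro z hz
    have h3 := continuous_norm.frontier_preimage_subset _ hz
    rw [frontier_Ioo (hRR.trans hR), mem_preimage] at h3
    refine (norm_mul_le _ _).trans ?_
    rcases h3 with h3 | h3
    · rw [mul_pow]
      exact mul_le_mul (H1 z h3) (H2 _ (by rw [norm_inv, h3, inv_inv])) (norm_nonneg _)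
        (by positivity)
    · rw [mul_comm α, mul_pow]
      exact mul_le_mul (H2 z h3) (H1 _ (by rw [norm_inv, h3])) (norm_nonneg _) (by positivity)
  have h4 := Complex.norm_le_of_forall_mem_frontier_norm_le hU hd hfr
    (z := 1) (subset_closure (show ‖(1 : ℂ)‖ ∈ Ioo R⁻¹ R by simpa using ⟨hRR, hR⟩))
  refine spectralRadius_le_of_norm_pow_le (Real.sqrt_nonneg _) (n := 2 * N) (by simpa using hN) ?_
  rw [pow_mul √(α * β), Real.sq_sqrt (by positivity)]
  simpa [← pow_add, two_mul] using h4

end BanachAlgebra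

/-! ### Square roots and the separating space for a possibly discontinuous involution -/

section BanachStarAlgebra

variable {B : Type*} [NormedRing B] [NormedAlgebra ℂ B] [CompleteSpace B] [StarRing B]
  [StarModule ℂ B]

theorem spectralRadius_star {B : Type*} [NormedRing B] [NormedAlgebra ℂ B] [StarRing B]
    [StarModule ℂ B] (x : B) : spectralRadius ℂ (star x) = spectralRadius ℂ x := by
  have key : ∀ y : B, spectralRadius ℂ (star y) ≤ spectralRadius ℂ y := fun y => by
    refine iSup₂_le fun k hk => ?_
    rw [spectrum.map_star, Set.mem_star] at hk
    have := le_iSup₂ (f := fun (k : ℂ) (_ : k ∈ spectrum ℂ y) => (‖k‖₊ : ENNReal)) (star k) hk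
    rwa [nnnorm_star] at this
  exact (key x).antisymm (by simpa using key (star x))

end BanachStarAlgebra

section BanachStarAlgebra

variable {B : Type*} [NormedRing B] [NormedAlgebra ℂ B] [CompleteSpace B] [NormOneClass B]
  [StarRing B] [StarModule ℂ B]

/-- The equation `2 q = h + q²`, that is, `1 - h = (1 - q)²`, has a small solution in the bicommutant
of `h`. -/
theorem exists_two_nsmul_eq_add_mul_self {B : Type*} [NormedRing B] [NormedAlgebra ℂ B]
    [CompleteSpace B] {h : B} (h1 : ‖h‖ < 1) :
    ∃ q ∈ centralizer (centralizer {h}), ‖q‖ < 1 ∧ 2 • q = h + q * q := by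
  -- The ball is preserved since (‖h‖ + ‖h‖²)/2 ≤ ‖h‖, and the map is ‖h‖-Lipschitz there. The
  -- bicommutant is closed, so it contains the fixed point.
  let S : Set B := Metric.closedBall 0 ‖h‖ ∩ centralizer (centralizer {h})
  let T : B → B := fun q => (2⁻¹ : ℂ) • (h + q * q)
  have hSc : IsComplete S := (Metric.isClosed_closedBall.inter (isClosed_centralizer _)).isComplete
  have h0 : (0 : B) ∈ S := ⟨by simp, zero_mem_centralizer⟩
  have hTS : MapsTo T S S := by
    rintro q ⟨hq, hqc⟩
    rw [mem_closedBall_zero_iff] at hq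
    refine ⟨?_, ?_⟩
    · rw [mem_closedBall_zero_iff, norm_smul]
      have h2 : ‖h + q * q‖ ≤ ‖h‖ + ‖q‖ * ‖q‖ :=
        (norm_add_le _ _).trans (by gcongr; exact norm_mul_le _ _)
      have : ‖(2⁻¹ : ℂ)‖ = 2⁻¹ := by simp
      rw [this]
      nlinarith [norm_nonneg q]
    · intro y hy
      have hqy : y * q = q * y := hqc y hy
      have hhy : y * h = h * y := (hy h rfl).symm
      change y * ((2⁻¹ : ℂ) • (h + q * q)) = ((2⁻¹ : ℂ) • (h + q * q)) * y
      rw [mul_smul_comm, smul_mul_assoc, mul_add, add_mul, hhy, ← mul_assoc, hqy, mul_assoc, hqy,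
        ← mul_assoc]
  have hTc : ContractingWith ‖h‖₊ (hTS.restrict T S S) := by
    refine ⟨by exact_mod_cast h1, LipschitzWith.of_dist_le_mul ?_⟩
    rintro ⟨q, hq, -⟩ ⟨p, hp, -⟩
    rw [mem_closedBall_zero_iff] at hp hq
    change dist (T q) (T p) ≤ ‖h‖ * dist q p
    rw [dist_eq_norm, dist_eq_norm]
    have h2 : T q - T p = (2⁻¹ : ℂ) • (q * (q - p) + (q - p) * p) := by
      simp only [T, ← smul_sub]
      congr 1
      noncomm_ring
    have h3 : ‖q * (q - p) + (q - p) * p‖ ≤ ‖h‖ * ‖q - p‖ + ‖q - p‖ * ‖h‖ := by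
      refine (norm_add_le _ _).trans (add_le_add ?_ ?_)
      · exact (norm_mul_le _ _).trans (by gcongr)
      · exact (norm_mul_le _ _).trans (by gcongr)
    rw [h2, norm_smul]
    have : ‖(2⁻¹ : ℂ)‖ = 2⁻¹ := by simp
    rw [this]
    linarith
  obtain ⟨q, ⟨hq, hqc⟩, hfix, -⟩ := hTc.exists_fixedPoint' hSc hTS h0 (edist_ne_top _ _)
  refine ⟨q, hqc, (mem_closedBall_zero_iff.1 hq).trans_lt h1, ?_⟩
  have h4 : (2⁻¹ : ℂ) • (h + q * q) = q := hfix
  rw [← Nat.cast_smul_eq_nsmul ℂ, ← h4]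
  nth_rewrite 1 [smul_smul]
  rw [h4]
  norm_num

/-- **Ford's square root lemma**: for self-adjoint `h` of norm less than `1`, the element `1 - h` has
a self-adjoint square root `1 - q`, even if the involution is discontinuous. -/
theorem exists_isSelfAdjoint_two_nsmul_eq_add_mul_self {h : B} (hh : IsSelfAdjoint h)
    (h1 : ‖h‖ < 1) : ∃ q : B, IsSelfAdjoint q ∧ 2 • q = h + q * q := by
  obtain ⟨q, hqc, hq1, hq⟩ := exists_two_nsmul_eq_add_mul_self h1
  refine ⟨q, ?_, hq⟩
  -- Membership in the bicommutant is used twice: q commutes with h, so q* does too, and therefore q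
  -- commutes with q*.
  have hqh : h * q = q * h := hqc h (by simp [mem_centralizer_iff])
  have hqsh : h * star q = star q * h := by
    have := congrArg star hqh
    rw [star_mul, star_mul, hh.star_eq] at this
    exact this.symm
  have hcomm : Commute (star q) q := hqc (star q) (by simpa [mem_centralizer_iff] using hqsh)
  have hq' : 2 • star q = h + star q * star q := by
    have := congrArg star hq
    rwa [star_nsmul, star_add, star_mul, hh.star_eq] at this
  set d := q - star q with hd
  -- Uniqueness of the fixed point is not available for q*, whose norm is uncontrolled. Instead,
  -- subtracting the two equations gives d (q + q*) = 2 d.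
  have hdq : d * star q = d * (2 - q) := by
    have h2 : d * q + d * star q = 2 • d := by
      rw [hd, smul_sub, hq, hq', sub_mul, sub_mul, hcomm.eq]
      abel
    rw [mul_sub, eq_sub_iff_add_eq, add_comm, h2, mul_two, two_smul]
  obtain ⟨u, hu⟩ : IsUnit (2 - q) := by
    have h3 : IsUnit (1 - (2⁻¹ : ℂ) • q) := isUnit_one_sub_of_norm_lt_one (by
      rw [norm_smul]
      have : ‖(2⁻¹ : ℂ)‖ = 2⁻¹ := by simp
      rw [this]
      linarith [norm_nonneg q])
    have h4 : (2 - q : B) = algebraMap ℂ B 2 * (1 - (2⁻¹ : ℂ) • q) := by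
      rw [← Algebra.smul_def, smul_sub, smul_smul]
      norm_num
      rw [two_smul, one_add_one_eq_two]
    rw [h4]
    exact ((isUnit_iff_ne_zero.2 (two_ne_zero (α := ℂ))).map (algebraMap ℂ B)).mul h3
  set t : B := ↑u⁻¹ with ht
  have ht1 : (2 - q) * t = 1 := by rw [← hu, ht, Units.mul_inv]
  have htn : ‖t‖ < 1 := by
    have h5 : 2 • t = 1 + q * t := by
      rw [sub_mul, sub_eq_iff_eq_add, two_mul, ← two_smul ℕ] at ht1
      exact ht1
    have h6 : 2 * ‖t‖ ≤ 1 + ‖q‖ * ‖t‖ := by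
      calc 2 * ‖t‖ = ‖2 • t‖ := by
            rw [← Nat.cast_smul_eq_nsmul ℂ, norm_smul]
            simp
        _ ≤ 1 + ‖q‖ * ‖t‖ := by
            rw [h5]
            refine (norm_add_le _ _).trans ?_
            rw [norm_one]
            gcongr
            exact norm_mul_le _ _
    nlinarith [norm_nonneg t]
  have hsqt : Commute (star q) t := by
    have h7 : Commute (star q) (u : B) := by
      rw [hu]
      exact (Commute.ofNat_right _ 2).sub_right hcomm
    exact h7.units_inv_right
  have hdt : d * (star q * t) = d := by rw [← mul_assoc, hdq, mul_assoc, ht1, mul_one]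
  have hpow : ∀ n : ℕ, d = d * (star q ^ n * t ^ n) := fun n => by
    rw [← hsqt.mul_pow]
    induction n with
    | zero => simp
    | succ n ih => rw [pow_succ', ← mul_assoc, hdt, ← ih]
  have hlim : Tendsto (fun n : ℕ => ‖d‖ * ‖t‖ ^ n) atTop (𝓝 0) := by
    simpa using (tendsto_pow_atTop_nhds_zero_of_lt_one (norm_nonneg t) htn).const_mul ‖d‖
  -- Only the spectral radius of q* is known to be below 1. This bounds its high powers, while ‖t‖ <
  -- 1 makes the factor t^n decay.
  have hev : ∀ᶠ n : ℕ in atTop, ‖d‖ ≤ ‖d‖ * ‖t‖ ^ n := by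
    have h8 : spectralRadius ℂ (star q) < ENNReal.ofReal 1 := by
      rw [spectralRadius_star]
      exact spectralRadius_lt_of_norm_lt hq1
    filter_upwards [eventually_norm_pow_le_of_spectralRadius_lt h8, eventually_gt_atTop 0]
      with n hn hn0
    calc ‖d‖ = ‖d * (star q ^ n * t ^ n)‖ := by rw [← hpow n]
      _ ≤ ‖d‖ * (‖star q ^ n‖ * ‖t ^ n‖) :=
        (norm_mul_le _ _).trans (by gcongr; exact norm_mul_le _ _)
      _ ≤ ‖d‖ * (1 * ‖t‖ ^ n) := by
        gcongr
        · simpa using hn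
        · exact norm_pow_le' _ hn0
      _ = ‖d‖ * ‖t‖ ^ n := by rw [one_mul]
  have hd0 : d = 0 := norm_le_zero_iff.1 (ge_of_tendsto hlim hev)
  exact (sub_eq_zero.1 hd0).symm

/-- If `y` lies in the separating space of the involution, then `y* y` is quasinilpotent. -/
theorem spectralRadius_star_mul_self_lt_of_mem_closure {y : B}
    (hy : ((0 : B), y) ∈ closure (range fun x : B => (x, star x))) {c : ℝ} (hc : 0 < c) :
    spectralRadius ℂ (star y * y) < ENNReal.ofReal c := by
  set w := star y * y with hw
  have hws : star w = w := by simp [hw]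
  -- With circles of radii t⁻² and t², the final bound is (‖w‖ + 3)/t, which this t makes smaller
  -- than c.
  set t : ℝ := 1 + (‖w‖ + 3) / c with ht
  have hpos : 0 < (‖w‖ + 3) / c := by positivity
  have ht1 : 1 < t := by linarith
  have hR : 1 < t ^ 2 := by nlinarith
  obtain ⟨δ, hδ0, hδ1, hδ2⟩ : ∃ δ : ℝ, 0 < δ ∧ ‖star y‖ * δ ≤ (t ^ 2)⁻¹ ∧
      (1 + t ^ 2) * (δ * ‖y‖) ≤ 1 := by
    refine ⟨((1 + t ^ 2) * (1 + ‖y‖ + ‖star y‖))⁻¹, by positivity, ?_, ?_⟩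
    · rw [mul_inv]
      have h1 : ‖star y‖ * (1 + ‖y‖ + ‖star y‖)⁻¹ ≤ 1 := by
        rw [← div_eq_mul_inv]
        exact div_le_one_of_le₀ (by linarith [norm_nonneg y]) (by positivity)
      have h2 : (1 + t ^ 2)⁻¹ ≤ (t ^ 2)⁻¹ := by gcongr; linarith
      calc _ = (1 + t ^ 2)⁻¹ * (‖star y‖ * (1 + ‖y‖ + ‖star y‖)⁻¹) := by ring
        _ ≤ (t ^ 2)⁻¹ * 1 := by gcongr
        _ = _ := mul_one _
    · rw [mul_inv, ← mul_assoc, ← mul_assoc, mul_inv_cancel₀ (by positivity), one_mul, mul_comm,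
        ← div_eq_mul_inv]
      exact div_le_one_of_le₀ (by linarith [norm_nonneg (star y)]) (by positivity)
  obtain ⟨_, ⟨x, rfl⟩, hx⟩ := Metric.mem_closure_iff.1 hy δ hδ0
  rw [Prod.dist_eq, max_lt_iff] at hx
  have hx1 : ‖x‖ < δ := by simpa using hx.1
  have hx2 : ‖y - star x‖ < δ := by simpa [dist_eq_norm] using hx.2
  -- Both w - z = y* (y - x*) and z* = x y are small, although z itself is close to w.
  set z := star y * star x with hz
  have hwz : ‖w - z‖ ≤ (t ^ 2)⁻¹ := by
    rw [hw, hz, ← mul_sub]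
    exact (norm_mul_le _ _).trans ((by gcongr : _ ≤ ‖star y‖ * δ).trans hδ1)
  have hzs : (1 + t ^ 2) * ‖star z‖ ≤ 1 := by
    rw [hz, star_mul, star_star, star_star]
    refine le_trans ?_ hδ2
    gcongr
    exact (norm_mul_le _ _).trans (by gcongr)
  have hR1 : (t ^ 2)⁻¹ ≤ 1 := (inv_lt_one_of_one_lt₀ hR).le
  have hzn : ‖z‖ ≤ ‖w‖ + 1 := by
    calc ‖z‖ = ‖w - (w - z)‖ := by rw [sub_sub_cancel]
      _ ≤ ‖w‖ + ‖w - z‖ := norm_sub_le _ _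
      _ ≤ ‖w‖ + 1 := by linarith
  have ht2 : 0 < (t ^ 2)⁻¹ := by positivity
  have key := spectralRadius_add_le_of_circles (a := w - z) (b := z) hR
    (α := (‖w‖ + 3) * (t ^ 2)⁻¹) (β := ‖w‖ + 3) (by positivity) (by positivity)
    (fun s hs => by
      apply spectralRadius_lt_of_norm_lt
      calc ‖w - z + s • z‖ ≤ ‖w - z‖ + ‖s‖ * ‖z‖ := (norm_add_le _ _).trans_eq (by rw [norm_smul])
        _ ≤ (t ^ 2)⁻¹ + (t ^ 2)⁻¹ * (‖w‖ + 1) := by rw [hs]; gcongr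
        _ < (‖w‖ + 3) * (t ^ 2)⁻¹ := by linarith)
    (fun s hs => by
      -- On the large circle s z is large but its adjoint is not; the spectral radius does not see
      -- the difference.
      rw [← spectralRadius_star]
      apply spectralRadius_lt_of_norm_lt
      rw [star_add, star_sub, star_smul, hws]
      calc ‖w - star z + star s • star z‖ ≤ ‖w‖ + ‖star z‖ + ‖s‖ * ‖star z‖ := by
            refine (norm_add_le _ _).trans ?_
            rw [norm_smul, norm_star]
            gcongr
            exact norm_sub_le _ _
        _ ≤ ‖w‖ + 1 := by rw [hs]; linarith
        _ < ‖w‖ + 3 := by linarith)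
  rw [sub_add_cancel] at key
  refine key.trans_lt ((ENNReal.ofReal_lt_ofReal_iff hc).2 ?_)
  have h9 : (‖w‖ + 3) * (t ^ 2)⁻¹ * (‖w‖ + 3) = ((‖w‖ + 3) / t) ^ 2 := by
    rw [div_pow]; ring
  rw [h9, Real.sqrt_sq (by positivity), div_lt_iff₀ (by positivity)]
  have : c * t = c + (‖w‖ + 3) := by rw [ht]; field_simp
  linarith

end BanachStarAlgebra

/-! ### Automatic continuity of `*`-actions on pre-Hilbert spaces -/

section Actions

variable {X : Type*} [SeminormedAddCommGroup X] [InnerProductSpace ℂ X]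

/-- Iterates ‖T a‖² = ⟪T² a, a⟫ ≤ ‖T² a‖ ‖a‖, replacing T by T². The extra factors ‖a‖ avoid
division, since ‖a‖ may vanish. -/
theorem norm_apply_pow_two_pow_le {T : Module.End ℂ X} (hT : T.IsSymmetric) (a : X) (n : ℕ) :
    ‖T a‖ ^ 2 ^ n * ‖a‖ ≤ ‖(T ^ 2 ^ n) a‖ * ‖a‖ ^ 2 ^ n := by
  induction n generalizing T with
  | zero => simp
  | succ n ih =>
    have h1 : ‖T a‖ ^ 2 ≤ ‖(T ^ 2) a‖ * ‖a‖ := by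
      rw [← inner_self_eq_norm_sq (𝕜 := ℂ), ← hT, pow_two T, Module.End.mul_apply]
      exact (Complex.re_le_norm _).trans (norm_inner_le_norm _ _)
    have h2 := ih (hT.pow 2)
    rw [← pow_mul T, ← pow_succ'] at h2
    calc ‖T a‖ ^ 2 ^ (n + 1) * ‖a‖ = (‖T a‖ ^ 2) ^ 2 ^ n * ‖a‖ := by rw [← pow_mul, ← pow_succ']
      _ ≤ (‖(T ^ 2) a‖ * ‖a‖) ^ 2 ^ n * ‖a‖ := by gcongr
      _ = (‖(T ^ 2) a‖ ^ 2 ^ n * ‖a‖) * ‖a‖ ^ 2 ^ n := by rw [mul_pow]; ring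
      _ ≤ (‖(T ^ 2 ^ (n + 1)) a‖ * ‖a‖ ^ 2 ^ n) * ‖a‖ ^ 2 ^ n := by gcongr
      _ = ‖(T ^ 2 ^ (n + 1)) a‖ * ‖a‖ ^ 2 ^ (n + 1) := by rw [pow_succ 2 n]; ring

variable {B : Type*} [NormedRing B] [NormedAlgebra ℂ B] [CompleteSpace B] [NormOneClass B]
  [StarRing B] [StarModule ℂ B] {L : B →ₐ[ℂ] Module.End ℂ X}

/-- An action of a unital Banach `*`-algebra on a pre-Hilbert space that respects the involution. -/
def IsStarAction {B : Type*} [NormedRing B] [NormedAlgebra ℂ B] [StarRing B]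
    (L : B →ₐ[ℂ] Module.End ℂ X) : Prop :=
  ∀ (x : B) (a b : X), ⟪L x a, b⟫_ℂ = ⟪a, L (star x) b⟫_ℂ

theorem IsStarAction.isSymmetric_of_isSelfAdjoint {B : Type*} [NormedRing B] [NormedAlgebra ℂ B]
    [StarRing B] {L : B →ₐ[ℂ] Module.End ℂ X} (hL : IsStarAction L) {x : B}
    (hx : IsSelfAdjoint x) : (L x).IsSymmetric := fun a b => by
  rw [hL, hx.star_eq]

/-- For c > ‖h‖, Ford's lemma gives 1 - h/c = (1 - q)² with q self-adjoint, so ⟪(1 - h/c) a, a⟫ =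
‖(1 - q) a‖² ≥ 0. Then c tends to ‖h‖. -/
theorem IsStarAction.re_inner_le_of_isSelfAdjoint (hL : IsStarAction L) {h : B}
    (hh : IsSelfAdjoint h) (a : X) : (⟪L h a, a⟫_ℂ).re ≤ ‖h‖ * ‖a‖ ^ 2 := by
  have key : ∀ c : ℝ, ‖h‖ < c → (⟪L h a, a⟫_ℂ).re ≤ c * ‖a‖ ^ 2 := by
    intro c hc
    have hc0 : 0 < c := (norm_nonneg h).trans_lt hc
    have hk : IsSelfAdjoint (((c⁻¹ : ℝ) : ℂ) • h) :=
      IsSelfAdjoint.smul (Complex.conj_ofReal _) hh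
    have hk1 : ‖((c⁻¹ : ℝ) : ℂ) • h‖ < 1 := by
      rw [norm_smul, Complex.norm_real, norm_inv, Real.norm_of_nonneg hc0.le, inv_mul_lt_iff₀ hc0,
        mul_one]
      exact hc
    obtain ⟨q, hq, hqk⟩ := exists_isSelfAdjoint_two_nsmul_eq_add_mul_self hk hk1
    have h1 : ⟪a - L q a, a - L q a⟫_ℂ = ⟪a - L (((c⁻¹ : ℝ) : ℂ) • h) a, a⟫_ℂ := by
      have h2 : L (((c⁻¹ : ℝ) : ℂ) • h) a = (2 : ℂ) • L q a - L q (L q a) := by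
        have h3 : ((c⁻¹ : ℝ) : ℂ) • h = (2 : ℂ) • q - q * q := by
          rw [eq_sub_iff_add_eq, ← hqk, two_smul, two_smul]
        rw [h3, map_sub, map_smul, map_mul]
        rfl
      have h4 : ∀ b, ⟪b, L q a⟫_ℂ = ⟪L q b, a⟫_ℂ := fun b => by
        rw [hL, hq.star_eq]
      rw [h2, inner_sub_right, h4, ← inner_sub_left]
      congr 1
      rw [map_sub, two_smul]
      abel
    have h5 : 0 ≤ (⟪a - L (((c⁻¹ : ℝ) : ℂ) • h) a, a⟫_ℂ).re := by
      rw [← h1]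
      exact inner_self_nonneg (𝕜 := ℂ)
    rw [map_smul, LinearMap.smul_apply, inner_sub_left, inner_smul_left, Complex.conj_ofReal,
      Complex.sub_re, Complex.re_ofReal_mul] at h5
    have h6 : (⟪a, a⟫_ℂ).re = ‖a‖ ^ 2 := inner_self_eq_norm_sq (𝕜 := ℂ) a
    rw [h6, sub_nonneg, inv_mul_le_iff₀ hc0] at h5
    exact h5
  have hlim : Tendsto (fun c : ℝ => c * ‖a‖ ^ 2) (𝓝[>] ‖h‖) (𝓝 (‖h‖ * ‖a‖ ^ 2)) :=
    ((continuous_id.mul continuous_const).tendsto _).mono_left nhdsWithin_le_nhds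
  exact ge_of_tendsto hlim (eventually_mem_nhdsWithin.mono fun c hc => key c hc)

theorem IsStarAction.norm_apply_sq_le (hL : IsStarAction L) (x : B) (a : X) :
    ‖L x a‖ ^ 2 ≤ ‖star x * x‖ * ‖a‖ ^ 2 := by
  refine le_trans (le_of_eq ?_) (hL.re_inner_le_of_isSelfAdjoint (IsSelfAdjoint.star_mul_self x) a)
  rw [map_mul, Module.End.mul_apply, hL, star_star]
  exact (inner_self_eq_norm_sq (𝕜 := ℂ) _).symm

/-- A symmetric operator of a `*`-action is bounded by the spectral radius. -/
theorem IsStarAction.norm_apply_le_of_spectralRadius_lt (hL : IsStarAction L) {x : B} {c : ℝ}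
    (hx : (L x).IsSymmetric) (hc : spectralRadius ℂ x < ENNReal.ofReal c) (a : X) :
    ‖L x a‖ ≤ c * ‖a‖ := by
  have hc0 : 0 < c := ENNReal.ofReal_pos.1 (bot_le.trans_lt hc)
  have h2n : Tendsto (fun n : ℕ => 2 ^ n) atTop atTop := tendsto_pow_atTop_atTop_of_one_lt one_lt_two
  -- The norm of L (x^N) is controlled by ‖(x*)^N‖ ‖x^N‖, and x and x* have the same spectral
  -- radius.
  obtain ⟨n, h1, h2⟩ := ((h2n.eventually (eventually_norm_pow_le_of_spectralRadius_lt hc)).and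
    (h2n.eventually (eventually_norm_pow_le_of_spectralRadius_lt
      ((spectralRadius_star x).trans_lt hc)))).exists
  have h3 := norm_apply_pow_two_pow_le hx a n
  have hN : 2 ^ n ≠ 0 := by positivity
  generalize 2 ^ n = N at h1 h2 h3 hN
  have h4 : ‖(L x ^ N) a‖ ≤ c ^ N * ‖a‖ := by
    rw [← map_pow]
    refine le_of_sq_le_sq ?_ (by positivity)
    refine (hL.norm_apply_sq_le _ a).trans ?_
    rw [mul_pow, star_pow, pow_two (c ^ N)]
    gcongr
    exact (norm_mul_le _ _).trans (by gcongr)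
  rcases (norm_nonneg a).eq_or_lt with ha | ha
  · have h5 := hL.norm_apply_sq_le x a
    rw [← ha] at h5 ⊢
    have : ‖L x a‖ = 0 := by
      apply pow_eq_zero_iff two_ne_zero |>.1
      exact le_antisymm (by simpa using h5) (sq_nonneg _)
    simp [this]
  · refine le_of_pow_le_pow_left₀ hN (by positivity) ?_
    refine le_of_mul_le_mul_right (h3.trans ?_) ha
    rw [mul_pow]
    calc _ ≤ c ^ N * ‖a‖ * ‖a‖ ^ N := by gcongr
      _ = _ := by ring

/-- The separating space of the involution acts by zero. -/
theorem IsStarAction.norm_apply_eq_zero_of_mem_closure (hL : IsStarAction L) {y : B}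
    (hy : ((0 : B), y) ∈ closure (range fun x : B => (x, star x))) (a : X) : ‖L y a‖ = 0 := by
  have h1 : ‖L (star y * y) a‖ ≤ 0 := by
    have hlim : Tendsto (fun c : ℝ => c * ‖a‖) (𝓝[>] 0) (𝓝 (0 * ‖a‖)) :=
      ((continuous_id.mul continuous_const).tendsto _).mono_left nhdsWithin_le_nhds
    rw [zero_mul] at hlim
    exact ge_of_tendsto hlim (eventually_mem_nhdsWithin.mono fun c hc =>
      hL.norm_apply_le_of_spectralRadius_lt
        (hL.isSymmetric_of_isSelfAdjoint (IsSelfAdjoint.star_mul_self y))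
        (spectralRadius_star_mul_self_lt_of_mem_closure hy hc) a)
  have h2 : ‖L y a‖ ^ 2 ≤ ‖L (star y * y) a‖ * ‖a‖ := by
    rw [← inner_self_eq_norm_sq (𝕜 := ℂ), ← star_star y, ← hL, star_star, map_mul,
      Module.End.mul_apply]
    exact (Complex.re_le_norm _).trans (norm_inner_le_norm _ _)
  have h3 : ‖L y a‖ ^ 2 = 0 :=
    le_antisymm (h2.trans (mul_nonpos_of_nonpos_of_nonneg h1 (norm_nonneg a))) (sq_nonneg _)
  exact (pow_eq_zero_iff two_ne_zero).1 h3

/-- The involution is continuous up to its separating space. -/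
theorem exists_norm_le_mem_closure_graph_star (B : Type*) [NormedRing B] [NormedAlgebra ℂ B]
    [CompleteSpace B] [StarRing B] [StarModule ℂ B] :
    ∃ c : ℝ, 0 < c ∧ ∀ x : B, ∃ v : B, ‖v‖ ≤ c * ‖x‖ ∧
      ((0 : B), v - star x) ∈ closure (range fun x : B => (x, star x)) := by
  let starₗ : B →ₗ[ℝ] B :=
    { toFun := star
      map_add' := star_add
      map_smul' := fun r x => by
        have h : ∀ y : B, r • y = (r : ℂ) • y := fun y => (Complex.coe_smul r y).symm
        rw [RingHom.id_apply, h, h, star_smul]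
        simp }
  have hgraph : (starₗ.graph : Set (B × B)) = range fun x : B => (x, star x) := by
    ext ⟨x, y⟩
    simp [starₗ, eq_comm]
  let G : Submodule ℝ (B × B) := starₗ.graph.topologicalClosure
  have hGmem : ∀ p, p ∈ G ↔ p ∈ closure (range fun x : B => (x, star x)) := fun p => by
    rw [← hgraph]
    rfl
  have : CompleteSpace G := starₗ.graph.isClosed_topologicalClosure.completeSpace_coe
  let P : G →L[ℝ] B := (ContinuousLinearMap.fst ℝ B B).comp G.subtypeL
  have hst : ∀ x : B, (x, star x) ∈ G := fun x => (hGmem _).2 (subset_closure ⟨x, rfl⟩)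
  -- Open mapping theorem for the first projection of the closed graph closure, which is onto
  -- because the graph already is.
  obtain ⟨c, hc, H⟩ := P.exists_preimage_norm_le fun x => ⟨⟨(x, star x), hst x⟩, rfl⟩
  refine ⟨c, hc, fun x => ?_⟩
  obtain ⟨⟨⟨x', v⟩, hG⟩, rfl : x' = x, hn⟩ := H x
  refine ⟨v, (norm_snd_le (x', v)).trans hn, ?_⟩
  rw [← hGmem]
  simpa using G.sub_mem hG (hst x')

/-- A `*`-action of a Banach `*`-algebra is automatically continuous, even if the involution is
not. -/
theorem IsStarAction.exists_norm_apply_le (hL : IsStarAction L) :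
    ∃ K : ℝ, 0 ≤ K ∧ ∀ (x : B) (a : X), ‖L x a‖ ≤ K * ‖x‖ * ‖a‖ := by
  obtain ⟨c, hc, H⟩ := exists_norm_le_mem_closure_graph_star B
  refine ⟨√c, Real.sqrt_nonneg c, fun x a => ?_⟩
  obtain ⟨v, hv, hmem⟩ := H x
  have h0 : ∀ b, ‖L (v * x) b - L (star x * x) b‖ = 0 := fun b => by
    rw [← LinearMap.sub_apply, ← map_sub, ← sub_mul, map_mul, Module.End.mul_apply]
    exact hL.norm_apply_eq_zero_of_mem_closure hmem _
  have h1 : ∀ b d, ⟪L (v * x) b, d⟫_ℂ = ⟪L (star x * x) b, d⟫_ℂ := fun b d => by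
    rw [← sub_eq_zero, ← inner_sub_left, ← norm_le_zero_iff]
    exact (norm_inner_le_norm _ _).trans (by rw [h0, zero_mul])
  -- The element v x need not be self-adjoint, but its operator agrees with that of x* x up to null
  -- vectors.
  have hsym : (L (v * x)).IsSymmetric := fun b d => by
    rw [h1, hL.isSymmetric_of_isSelfAdjoint (IsSelfAdjoint.star_mul_self x),
      ← inner_conj_symm, ← h1, inner_conj_symm]
  have h2 : ‖L (v * x) a‖ ≤ ‖v * x‖ * ‖a‖ := by
    have hlim : Tendsto (fun r : ℝ => r * ‖a‖) (𝓝[>] ‖v * x‖) (𝓝 (‖v * x‖ * ‖a‖)) :=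
      ((continuous_id.mul continuous_const).tendsto _).mono_left nhdsWithin_le_nhds
    exact ge_of_tendsto hlim (eventually_mem_nhdsWithin.mono fun r hr =>
      hL.norm_apply_le_of_spectralRadius_lt hsym (spectralRadius_lt_of_norm_lt hr) a)
  have h3 : ‖L x a‖ ^ 2 ≤ ‖L (v * x) a‖ * ‖a‖ := by
    have : (⟪L (v * x) a, a⟫_ℂ).re = ‖L x a‖ ^ 2 := by
      rw [h1, map_mul, Module.End.mul_apply, hL, star_star]
      exact inner_self_eq_norm_sq (𝕜 := ℂ) _
    rw [← this]
    exact (Complex.re_le_norm _).trans (norm_inner_le_norm _ _)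
  refine le_of_sq_le_sq ?_ (by positivity)
  calc ‖L x a‖ ^ 2 ≤ ‖L (v * x) a‖ * ‖a‖ := h3
    _ ≤ (c * ‖x‖ * ‖x‖ * ‖a‖) * ‖a‖ := by
      gcongr
      exact h2.trans (by gcongr; exact (norm_mul_le _ _).trans (by gcongr))
    _ = (√c * ‖x‖ * ‖a‖) ^ 2 := by rw [mul_pow, mul_pow, Real.sq_sqrt hc.le]; ring

end Actions

/-! ### Reduction to the unital case through the ℓ¹ unitization -/

section Unitization

variable {𝒜 : Type*} [NonUnitalNormedRing 𝒜] [NormedSpace ℂ 𝒜] [IsScalarTower ℂ 𝒜 𝒜]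
  [SMulCommClass ℂ 𝒜 𝒜] [StarRing 𝒜] [StarModule ℂ 𝒜]

instance instNormOneClassUnitization : NormOneClass (WithLp 1 (Unitization ℂ 𝒜)) :=
  ⟨by rw [WithLp.unitization_norm_def]
      change ‖(1 : Unitization ℂ 𝒜).fst‖ + ‖(1 : Unitization ℂ 𝒜).snd‖ = 1
      simp⟩

instance instStarRingUnitization : StarRing (WithLp 1 (Unitization ℂ 𝒜)) where
  star x := WithLp.toLp 1 (star (WithLp.ofLp x))
  star_involutive x := congrArg (WithLp.toLp 1) (star_star (WithLp.ofLp x))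
  star_mul x y := congrArg (WithLp.toLp 1) (star_mul (WithLp.ofLp x) (WithLp.ofLp y))
  star_add x y := congrArg (WithLp.toLp 1) (star_add (WithLp.ofLp x) (WithLp.ofLp y))

instance instStarModuleUnitization : StarModule ℂ (WithLp 1 (Unitization ℂ 𝒜)) where
  star_smul c x := congrArg (WithLp.toLp 1) (star_smul c (WithLp.ofLp x))

variable {X : Type*} [SeminormedAddCommGroup X] [InnerProductSpace ℂ X]

/-- A `*`-action of a not necessarily unital Banach `*`-algebra on a pre-Hilbert space is
automatically continuous, even if the involution is not. -/
theorem exists_norm_apply_le_of_star_action [CompleteSpace 𝒜] (L : 𝒜 →ₙₐ[ℂ] Module.End ℂ X)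
    (hL : ∀ (x : 𝒜) (a b : X), ⟪L x a, b⟫_ℂ = ⟪a, L (star x) b⟫_ℂ) :
    ∃ K : ℝ, 0 ≤ K ∧ ∀ (x : 𝒜) (a : X), ‖L x a‖ ≤ K * ‖x‖ * ‖a‖ := by
  let L' : WithLp 1 (Unitization ℂ 𝒜) →ₐ[ℂ] Module.End ℂ X :=
    (Unitization.lift L).comp (WithLp.unitizationAlgEquiv ℂ).toAlgHom
  have hL'a : ∀ x a, L' x a = (WithLp.ofLp x).fst • a + L (WithLp.ofLp x).snd a := fun x a => by
    change Unitization.lift L (WithLp.ofLp x) a = _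
    rfl
  have hL' : IsStarAction L' := fun x a b => by
    have h1 : (WithLp.ofLp (star x)).fst = conj (WithLp.ofLp x).fst := rfl
    have h2 : (WithLp.ofLp (star x)).snd = star (WithLp.ofLp x).snd := rfl
    rw [hL'a, hL'a, inner_add_left, inner_add_right, inner_smul_left, inner_smul_right, hL, h1, h2]
  obtain ⟨K, hK, H⟩ := hL'.exists_norm_apply_le
  refine ⟨K, hK, fun x a => ?_⟩
  have h3 := H (WithLp.toLp 1 (x : Unitization ℂ 𝒜)) a
  rw [WithLp.unitization_norm_inr, hL'a] at h3
  simpa using h3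

end Unitization

/-! ### Extension of a bounded action to the Hilbert space -/

section Extension

variable {𝒜 : Type*} [NonUnitalNormedRing 𝒜] [NormedSpace ℂ 𝒜] [StarRing 𝒜]
  {E : Type*} [AddCommGroup E] [Module ℂ E]
  {H : Type*} [NormedAddCommGroup H] [InnerProductSpace ℂ H] [CompleteSpace H]

/-- A bounded `*`-action on a dense subspace of a Hilbert space extends to a
`*`-representation. -/
theorem exists_starAlgHom_extending (L : 𝒜 →ₙₐ[ℂ] Module.End ℂ E) {e : E →ₗ[ℂ] H}
    (he : DenseRange e) (hbd : ∀ x, ∃ K : ℝ, ∀ a, ‖e (L x a)‖ ≤ K * ‖e a‖)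
    (hL : ∀ (x : 𝒜) (a b : E), ⟪e (L x a), e b⟫_ℂ = ⟪e a, e (L (star x) b)⟫_ℂ) :
    ∃ π : 𝒜 →⋆ₙₐ[ℂ] (H →L[ℂ] H), ∀ x a, π x (e a) = e (L x a) := by
  let P : 𝒜 → H →L[ℂ] H := fun x => (e ∘ₗ L x).extendOfNorm e
  have hP : ∀ x a, P x (e a) = e (L x a) := fun x a => LinearMap.extendOfNorm_eq he (hbd x) a
  have hext : ∀ S T : H →L[ℂ] H, (∀ a, S (e a) = T (e a)) → S = T := fun S T h =>
    ContinuousLinearMap.coeFn_injective (he.equalizer S.continuous T.continuous (funext h))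
  refine ⟨{ toFun := P, map_smul' := fun c x => ?_, map_zero' := ?_, map_add' := fun x y => ?_,
            map_mul' := fun x y => ?_, map_star' := fun x => ?_ }, hP⟩
  · exact hext _ _ fun a => by simp [hP]
  · exact hext _ _ fun a => by simp [hP]
  · exact hext _ _ fun a => by simp [hP]
  · exact hext _ _ fun a => by simp [hP]
  · rw [ContinuousLinearMap.star_eq_adjoint, ContinuousLinearMap.eq_adjoint_iff]
    intro u v
    refine he.induction_on₂ (p := fun u v => ⟪P (star x) u, v⟫_ℂ = ⟪u, P x v⟫_ℂ) ?_ ?_ u v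
    · exact isClosed_eq (by fun_prop) (by fun_prop)
    · intro a b
      rw [hP, hP, hL, star_star]

end Extension

/-! ### The form on the left ideal and the bounds for the induced operator -/

section Functionals

variable {𝒜 : Type*} [NonUnitalNormedRing 𝒜] [NormedSpace ℂ 𝒜] [StarRing 𝒜]

theorem IsLeftIdeal.mul_star_mul {M : Submodule ℂ 𝒜} (hM : IsLeftIdeal M) (x : 𝒜) (a b : M) :
    hM.mul (star (hM.mul x a : 𝒜)) b = hM.mul (star (a : 𝒜)) (hM.mul (star x) b) :=
  Subtype.ext (by simp [IsLeftIdeal.mul, mul_assoc])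

theorem IsCyclicBounded.norm_sq_le {M : Submodule ℂ 𝒜} {hM : IsLeftIdeal M}
    {f : M →ₗ[ℂ] ℂ} {C : ℝ} (hf : IsCyclicBounded hM f C) (a : M) :
    ‖f a‖ ^ 2 ≤ C * (f (hM.mul (star (a : 𝒜)) a)).re := by
  have h := (Complex.le_def.1 (hf a)).1
  rwa [Complex.ofReal_re, Complex.re_ofReal_mul] at h

theorem IsCyclicBounded.nonneg {M : Submodule ℂ 𝒜} {hM : IsLeftIdeal M}
    {f : M →ₗ[ℂ] ℂ} {C : ℝ} (hC : 0 ≤ C) (hf : IsCyclicBounded hM f C) (a : M) :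
    0 ≤ f (hM.mul (star (a : 𝒜)) a) := by
  rcases hC.eq_or_lt with rfl | hC
  -- For C = 0 the hypothesis says nothing about the sign of f(a* a), but it forces f = 0.
  · have h0 : ∀ b : M, f b = 0 := fun b => by
      have h1 := hf b
      rw [Complex.ofReal_zero, zero_mul] at h1
      have h2 : ‖f b‖ ^ 2 ≤ 0 := by exact_mod_cast h1
      exact norm_eq_zero.1 ((pow_eq_zero_iff two_ne_zero).1 (le_antisymm h2 (sq_nonneg _)))
    rw [h0]
  · have h1 : (0 : ℂ) ≤ (C : ℂ) * f (hM.mul (star (a : 𝒜)) a) :=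
      le_trans (by exact_mod_cast sq_nonneg ‖f a‖) (hf a)
    have hC' : (0 : ℂ) < C := by exact_mod_cast hC
    exact le_of_mul_le_mul_left (by rwa [mul_zero]) hC'

variable [IsScalarTower ℂ 𝒜 𝒜] [SMulCommClass ℂ 𝒜 𝒜] [StarModule ℂ 𝒜]

/-- Automatic continuity of a `*`-action, for a positive semidefinite form in place of a norm. -/
theorem exists_re_inner_apply_le_of_core [CompleteSpace 𝒜] {X : Type*} [AddCommGroup X]
    [Module ℂ X] (core : PreInnerProductSpace.Core ℂ X) (L : 𝒜 →ₙₐ[ℂ] Module.End ℂ X)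
    (hL : ∀ (x : 𝒜) (a b : X), core.inner (L x a) b = core.inner a (L (star x) b)) :
    ∃ K : ℝ, 0 ≤ K ∧ ∀ (x : 𝒜) (a : X),
      (core.inner (L x a) (L x a)).re ≤ K * ‖x‖ ^ 2 * (core.inner a a).re ∧
      (core.inner (L (star x) a) (L (star x) a)).re ≤ K * ‖x‖ ^ 2 * (core.inner a a).re := by
  let _ : SeminormedAddCommGroup X := InnerProductSpace.Core.toSeminormedAddCommGroup (c := core)
  let _ : InnerProductSpace ℂ X := InnerProductSpace.ofCore core
  obtain ⟨K, hK, H⟩ := exists_norm_apply_le_of_star_action L hL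
  have hn : ∀ a : X, (core.inner a a).re = ‖a‖ ^ 2 := fun a => inner_self_eq_norm_sq (𝕜 := ℂ) a
  refine ⟨K ^ 2, sq_nonneg K, fun x a => ?_⟩
  rw [hn, hn, hn, ← mul_pow, ← mul_pow]
  refine ⟨pow_le_pow_left₀ (norm_nonneg _) (H x a) 2,
    pow_le_pow_left₀ (norm_nonneg _) ?_ 2⟩
  -- The bound for x* in terms of ‖x‖ comes from the adjoint relation, since ‖x*‖ need not be
  -- bounded by a multiple of ‖x‖.
  have h1 : ‖L (star x) a‖ * ‖L (star x) a‖ ≤ K * ‖x‖ * ‖a‖ * ‖L (star x) a‖ := by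
    calc ‖L (star x) a‖ * ‖L (star x) a‖ = (⟪L x (L (star x) a), a⟫_ℂ).re := by
          rw [show ⟪L x (L (star x) a), a⟫_ℂ = ⟪L (star x) a, L (star x) a⟫_ℂ from hL _ _ _,
            ← pow_two]
          exact (inner_self_eq_norm_sq (𝕜 := ℂ) _).symm
      _ ≤ ‖L x (L (star x) a)‖ * ‖a‖ :=
          (Complex.re_le_norm _).trans (norm_inner_le_norm _ _)
      _ ≤ K * ‖x‖ * ‖L (star x) a‖ * ‖a‖ := by gcongr; exact H _ _
      _ = _ := by ring
  rcases (norm_nonneg (L (star x) a)).eq_or_lt with h0 | h0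
  · rw [← h0]; positivity
  · exact le_of_mul_le_mul_right h1 h0

variable {M : Submodule ℂ 𝒜} (hM : IsLeftIdeal M)

/-- Left multiplication of the algebra on a left ideal. -/
def IsLeftIdeal.leftMul : 𝒜 →ₙₐ[ℂ] Module.End ℂ M where
  toFun x :=
    { toFun := hM.mul x
      map_add' := fun _ _ => Subtype.ext (mul_add _ _ _)
      map_smul' := fun _ _ => Subtype.ext (mul_smul_comm _ _ _) }
  map_smul' _ _ := LinearMap.ext fun _ => Subtype.ext (smul_mul_assoc _ _ _)
  map_zero' := LinearMap.ext fun _ => Subtype.ext (zero_mul _)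
  map_add' _ _ := LinearMap.ext fun _ => Subtype.ext (add_mul _ _ _)
  map_mul' _ _ := LinearMap.ext fun _ => Subtype.ext (mul_assoc _ _ _)

variable {hM} {f : M →ₗ[ℂ] ℂ} {C : ℝ}

/-- A positive functional on a left ideal is hermitian. -/
theorem apply_mul_star_comm (hpos : ∀ a : M, 0 ≤ f (hM.mul (star (a : 𝒜)) a)) (a b : M) :
    f (hM.mul (star (b : 𝒜)) a) = conj (f (hM.mul (star (a : 𝒜)) b)) := by
  have him : ∀ a : M, (f (hM.mul (star (a : 𝒜)) a)).im = 0 := fun a =>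
    ((Complex.nonneg_iff.1 (hpos a)).2).symm
  -- Polarization: the values c = 1 and c = i give the imaginary and real parts of the claim.
  have hadd : ∀ c : ℂ, f (hM.mul (star ((c • a + b : M) : 𝒜)) (c • a + b)) =
      conj c * c * f (hM.mul (star (a : 𝒜)) a) + conj c * f (hM.mul (star (a : 𝒜)) b) +
        c * f (hM.mul (star (b : 𝒜)) a) + f (hM.mul (star (b : 𝒜)) b) := fun c => by
    simp only [← smul_eq_mul, ← map_smul, ← map_add]
    congr 1
    refine Subtype.ext ?_
    simp only [IsLeftIdeal.mul, Submodule.coe_add, Submodule.coe_smul, star_add, star_smul,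
      add_mul, mul_add, smul_mul_assoc, mul_smul_comm, smul_add, mul_smul,
      smul_eq_mul, starRingEnd_apply, smul_comm c (star c)]
    abel
  have h1 := him ((1 : ℂ) • a + b)
  have h2 := him (Complex.I • a + b)
  have ha := him a
  have hb := him b
  rw [hadd] at h1 h2
  simp [ha, hb] at h1 h2
  apply Complex.ext
  · rw [Complex.conj_re]; linarith
  · rw [Complex.conj_im]; linarith

/-- The positive semidefinite form `⟨a, b⟩ = f(a* b)`, conjugate-linear in the first variable. -/
@[reducible]
def preCore (hpos : ∀ a : M, 0 ≤ f (hM.mul (star (a : 𝒜)) a)) : PreInnerProductSpace.Core ℂ M where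
  inner a b := f (hM.mul (star (a : 𝒜)) b)
  conj_inner_symm a b := (apply_mul_star_comm hpos b a).symm
  re_inner_nonneg a := (Complex.nonneg_iff.1 (hpos a)).1
  add_left a b c := by
    rw [← map_add]
    congr 1
    exact Subtype.ext (by simp [IsLeftIdeal.mul, add_mul])
  smul_left a b r := by
    rw [← smul_eq_mul, ← map_smul]
    congr 1
    exact Subtype.ext (by simp [IsLeftIdeal.mul, smul_mul_assoc])

/-- The first bound makes the representation bounded. The second, from the hypothesis at x* a, gives
both the continuity of A a and the Schwarz inequality. -/
theorem IsCyclicBounded.exists_re_mul_le [CompleteSpace 𝒜] (hC : 0 ≤ C)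
    (hf : IsCyclicBounded hM f C) :
    ∃ K : ℝ, 0 ≤ K ∧ ∀ (x : 𝒜) (a : M),
      (f (hM.mul (star (hM.mul x a : 𝒜)) (hM.mul x a))).re ≤
        K * ‖x‖ ^ 2 * (f (hM.mul (star (a : 𝒜)) a)).re ∧
      ‖f (hM.mul (star x) a)‖ ^ 2 ≤ C * (K * ‖x‖ ^ 2 * (f (hM.mul (star (a : 𝒜)) a)).re) := by
  obtain ⟨K, hK, H⟩ := exists_re_inner_apply_le_of_core (preCore (hf.nonneg hC)) hM.leftMul
    (fun x a b => congrArg f (hM.mul_star_mul x a b))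
  refine ⟨K, hK, fun x a => ⟨(H x a).1, ?_⟩⟩
  exact (hf.norm_sq_le _).trans (mul_le_mul_of_nonneg_left (H x a).2 hC)

theorem IsCyclicBounded.hasContinuousTranslates [CompleteSpace 𝒜] (hC : 0 ≤ C)
    (hf : IsCyclicBounded hM f C) : HasContinuousTranslates hM f := by
  obtain ⟨K, hK, H⟩ := hf.exists_re_mul_le hC
  intro a
  have hN : 0 ≤ (f (hM.mul (star (a : 𝒜)) a)).re := (Complex.nonneg_iff.1 (hf.nonneg hC a)).1
  let g : 𝒜 →+ ℂ := AddMonoidHom.mk' (fun x => f (hM.mul (star x) a)) fun x y => by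
    rw [← map_add]
    congr 1
    exact Subtype.ext (by simp [IsLeftIdeal.mul, add_mul])
  refine AddMonoidHomClass.continuous_of_bound g
    √(C * (K * (f (hM.mul (star (a : 𝒜)) a)).re)) fun x => ?_
  refine le_of_sq_le_sq ?_ (by positivity)
  rw [mul_pow, Real.sq_sqrt (by positivity)]
  exact ((H x a).2).trans_eq (by ring)

theorem IsCyclicBounded.isPositiveOp (hC : 0 ≤ C) (hf : IsCyclicBounded hM f C)
    (hcont : HasContinuousTranslates hM f) : IsPositiveOp (inducedOp hM f hcont) :=
  fun a => hf.nonneg hC a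

theorem IsCyclicBounded.isSchwarzBounded [CompleteSpace 𝒜] (hC : 0 ≤ C)
    (hf : IsCyclicBounded hM f C) (hcont : HasContinuousTranslates hM f) :
    IsSchwarzBounded (inducedOp hM f hcont) := by
  obtain ⟨K, hK, H⟩ := hf.exists_re_mul_le hC
  refine ⟨C * K, by positivity, fun (a : M) => ?_⟩
  have h0 := hf.nonneg hC a
  have hN : 0 ≤ (f (hM.mul (star (a : 𝒜)) a)).re := (Complex.nonneg_iff.1 h0).1
  have h1 : ‖inducedOp hM f hcont a‖ ≤ √(C * (K * (f (hM.mul (star (a : 𝒜)) a)).re)) := by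
    refine ContinuousLinearMap.opNorm_le_bound _ (Real.sqrt_nonneg _) fun x => ?_
    refine le_of_sq_le_sq ?_ (by positivity)
    rw [mul_pow, Real.sq_sqrt (by positivity)]
    exact ((H x a).2).trans_eq (by ring)
  have h2 : ‖inducedOp hM f hcont a‖ ^ 2 ≤ C * K * (f (hM.mul (star (a : 𝒜)) a)).re := by
    refine (pow_le_pow_left₀ (norm_nonneg _) h1 2).trans_eq ?_
    rw [Real.sq_sqrt (by positivity)]
    ring
  have h3 : f (hM.mul (star (a : 𝒜)) a) = ((f (hM.mul (star (a : 𝒜)) a)).re : ℂ) :=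
    Complex.eq_re_of_ofReal_le h0
  change _ ≤ _ * f (hM.mul (star (a : 𝒜)) a)
  rw [h3]
  exact_mod_cast h2

end Functionals

end KreinVonNeumann

end

/-! ### The representation and its cyclic vector -/

open KreinVonNeumann in
/-- Mathlib's inner product is linear in the second variable, so `inner ℂ ζ (π a ζ)` is
`⟨π(a) ζ, ζ⟩` in the convention where it is linear in the first. -/
theorem theorem5p3 {𝒜 : Type*} [NonUnitalNormedRing 𝒜] [CompleteSpace 𝒜] [NormedSpace ℂ 𝒜]
    [IsScalarTower ℂ 𝒜 𝒜] [SMulCommClass ℂ 𝒜 𝒜] [StarRing 𝒜] [StarModule ℂ 𝒜]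
    (M : Submodule ℂ 𝒜) (hM : IsLeftIdeal M) (f : M →ₗ[ℂ] ℂ)
    (C : ℝ) (hC : 0 ≤ C) (hf : IsCyclicBounded hM f C) :
    ∃ (hcont : HasContinuousTranslates hM f)
      (hA : IsPositiveOp (inducedOp hM f hcont))
      (hS : IsSchwarzBounded (inducedOp hM f hcont))
      (π : 𝒜 →⋆ₙₐ[ℂ] (AuxHilbert (inducedOp hM f hcont) hA hS →L[ℂ]
        AuxHilbert (inducedOp hM f hcont) hA hS))
      (ζ : AuxHilbert (inducedOp hM f hcont) hA hS),
      (∀ (x : 𝒜) (a : M),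
        π x (RanSpace.mk (inducedOp hM f hcont) hA hS a : AuxHilbert _ hA hS) =
          (RanSpace.mk (inducedOp hM f hcont) hA hS (hM.mul x a) : AuxHilbert _ hA hS)) ∧
      IsCyclicVector π ζ ∧
      ∀ a : M, f a = inner ℂ ζ (π (a : 𝒜) ζ) := by
  have hcont := hf.hasContinuousTranslates hC
  have hA := hf.isPositiveOp hC hcont
  have hS := hf.isSchwarzBounded hC hcont
  let e : M →ₗ[ℂ] AuxHilbert (inducedOp hM f hcont) hA hS :=
    (UniformSpace.Completion.toComplₗᵢ (𝕜 := ℂ)).toLinearMap ∘ₗ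
      RanSpace.mk (inducedOp hM f hcont) hA hS
  have he : DenseRange e := UniformSpace.Completion.denseRange_coe.comp
    (RanSpace.mk_surjective (inducedOp hM f hcont) hA hS).denseRange
    (UniformSpace.Completion.continuous_coe _)
  have hinner : ∀ a b : M, ⟪e a, e b⟫_ℂ = f (hM.mul (star (a : 𝒜)) b) := fun a b =>
    (UniformSpace.Completion.inner_coe _ _).trans
      (RanSpace.inner_mk_mk (A := inducedOp hM f hcont) (hA := hA) (hS := hS) a b)
  have hnorm : ∀ a : M, ‖e a‖ ^ 2 = (f (hM.mul (star (a : 𝒜)) a)).re := fun a => by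
    rw [← hinner]
    exact (inner_self_eq_norm_sq (𝕜 := ℂ) (e a)).symm
  obtain ⟨K, hK, H⟩ := hf.exists_re_mul_le hC
  have hadj : ∀ (x : 𝒜) (a b : M), ⟪e (hM.mul x a), e b⟫_ℂ = ⟪e a, e (hM.mul (star x) b)⟫_ℂ :=
    fun x a b => by rw [hinner, hinner, hM.mul_star_mul]
  obtain ⟨π, hπ⟩ := exists_starAlgHom_extending hM.leftMul he
    (fun x => ⟨√K * ‖x‖, fun a => by
      refine le_of_sq_le_sq ?_ (by positivity)
      rw [mul_pow, mul_pow, Real.sq_sqrt hK, hnorm, hnorm]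
      exact (H x a).1⟩) hadj
  have hfe : ∃ D : ℝ, ∀ a : M, ‖f a‖ ≤ D * ‖e a‖ := ⟨√C, fun a => by
    refine le_of_sq_le_sq ?_ (by positivity)
    rw [mul_pow, Real.sq_sqrt hC, hnorm]
    exact hf.norm_sq_le a⟩
  -- The Riesz vector of f, which descends to ran A and extends to H_A because |f(a)| ≤ √C ‖A a‖_A.
  let ζ := (InnerProductSpace.toDual ℂ _).symm (f.extendOfNorm e)
  have hζ : ∀ a : M, ⟪ζ, e a⟫_ℂ = f a := fun a => by
    rw [InnerProductSpace.toDual_symm_apply, LinearMap.extendOfNorm_eq he hfe]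
  -- Tested against the dense vectors A b: moving π(a) across turns the pairing into f(a* b), which
  -- is also the pairing of A a with A b.
  have hπζ : ∀ a : M, π (a : 𝒜) ζ = e a := fun a => by
    refine he.eq_of_inner_left ℂ fun b => ?_
    rw [← ContinuousLinearMap.adjoint_inner_right, ← ContinuousLinearMap.star_eq_adjoint, ← map_star,
      hπ, hζ, hinner]
    rfl
  refine ⟨hcont, hA, hS, π, ζ, hπ, he.mono ?_, fun a => ?_⟩
  · rintro _ ⟨a, rfl⟩
    exact ⟨a, hπζ a⟩
  · rw [hπζ, hζ]
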